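/- Work over the category $\mathbf{Top}$ of compactly generated Hausdorff spaces; $\mathbf{pshGpd}$ denotes the category of presheaves of (small) groupoids on $\mathbf{Top}$, with strict morphisms. For $\mathcal X\in\mathbf{pshGpd}$ let $\mathcal X_\Delta$ be the simplicial groupoid $[n]\mapsto \mathcal X(|\Delta^n|)$, and let $\mathrm{Sing}(\mathcal X)=\mathrm{Diag}(N(\mathcal X_\Delta))$ be the diagonal of its levelwise nerve. For a simplicial groupoid $X$ put $M_nX=\mathrm{Hom}(\partial\Delta^n,X)$ (the groupoid of maps of simplicial groupoids, where $\partial\Delta^n$ is viewed as a simplicial groupoid with only identity morphisms). A morphism $p:\mathcal X\to\mathcal Z$ is a Reedy fibration if for every $n\ge 0$ the functor $(\mathcal X_\Delta)_n\to M_n\mathcal X_\Delta\times_{M_n\mathcal Z_\Delta}(\mathcal Z_\Delta)_n$ into the strict fiber product is an isofibration of groupoids. For morphisms $p:\mathcal X\to\mathcal Z$ and $q:\mathcal Y\to\mathcal Z$, the strict fiber product $\mathcal X\times_{\mathcal Z}\mathcal Y$ and the 2-fiber product $\mathcal X\,\tilde\times_{\mathcal Z}\,\mathcal Y$ are formed objectwise;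 the objects of $(\mathcal X\,\tilde\times_{\mathcal Z}\,\mathcal Y)(T)$ are the triples $(x,y,\varphi)$ with $x\in\mathcal X(T)$, $y\in\mathcal Y(T)$ and $\varphi:p(x)\to q(y)$ in $\mathcal Z(T)$, and its morphisms are the pairs of morphisms compatible with the $\varphi$'s. **Lemma.** Let $p:\mathcal X\to\mathcal Z$ be a Reedy fibration of presheaves of groupoids and $q:\mathcal Y\to\mathcal Z$ any morphism. Then the natural map $$\mathrm{Sing}(\mathcal X)\times_{\mathrm{Sing}(\mathcal Z)}\mathrm{Sing}(\mathcal Y)\;\cong\;\mathrm{Sing}(\mathcal X\times_{\mathcal Z}\mathcal Y)\longrightarrow \mathrm{Sing}(\mathcal X\,\tilde\times_{\mathcal Z}\,\mathcal Y),$$ induced by $(x,y)\mapsto(x,y,\mathrm{id})$, is a weak equivalence of simplicial sets. Moreover it is natural: for every strict morphism $(\alpha,\beta,\gamma)$ from the diagram $(p,q)$ to a diagram $(p':\mathcal X'\to\mathcal Z',\;q':\mathcal Y'\to\mathcal Z')$, i.e. $\gamma p=p'\alpha$ and $\gamma q=q'\beta$, the maps for $(p,q)$ and $(p',q')$ commute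 with the induced maps of fiber products of singular simplicial sets and of 2-fiber products. -/

import Mathlib

open CategoryTheory Limits Simplicial Opposite

universe u v

namespace SingStack

/-! ### Strict fiber products and 2-fiber products of groupoids -/

section FiberProducts

variable {A B C A' B' C' A'' B'' C'' : Type v}
  [Groupoid.{v} A] [Groupoid.{v} B] [Groupoid.{v} C]
  [Groupoid.{v} A'] [Groupoid.{v} B'] [Groupoid.{v} C']
  [Groupoid.{v} A''] [Groupoid.{v} B''] [Groupoid.{v} C'']
  {D : Type*} [Category* D]

/-- Objects of the strict fiber product of groupoids `A ×_C B`: pairs of objects with the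
same image in `C`. -/
structure StrictPullback (F : A ⥤ C) (G : B ⥤ C) : Type v where
  fst : A
  snd : B
  eq : F.obj fst = G.obj snd

/-- Morphisms of the strict fiber product: pairs of morphisms with the same image in `C`. -/
@[ext]
structure StrictPullback.Hom {F : A ⥤ C} {G : B ⥤ C} (x y : StrictPullback F G) : Type v where
  fst : x.fst ⟶ y.fst
  snd : x.snd ⟶ y.snd
  w : F.map fst ≫ eqToHom y.eq = eqToHom x.eq ≫ G.map snd

instance (F : A ⥤ C) (G : B ⥤ C) : Category.{v} (StrictPullback F G) where
  Hom x y := StrictPullback.Hom x y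
  id x := ⟨𝟙 _, 𝟙 _, by simp⟩
  comp f g := ⟨f.fst ≫ g.fst, f.snd ≫ g.snd, by
    rw [F.map_comp, Category.assoc, g.w, reassoc_of% f.w, G.map_comp]⟩
  id_comp f := StrictPullback.Hom.ext (Category.id_comp _) (Category.id_comp _)
  comp_id f := StrictPullback.Hom.ext (Category.comp_id _) (Category.comp_id _)
  assoc f g h := StrictPullback.Hom.ext (Category.assoc _ _ _) (Category.assoc _ _ _)

theorem StrictPullback.hom_ext {F : A ⥤ C} {G : B ⥤ C} {x y : StrictPullback F G} {f g : x ⟶ y}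
    (h₁ : f.fst = g.fst) (h₂ : f.snd = g.snd) : f = g :=
  StrictPullback.Hom.ext h₁ h₂

instance (F : A ⥤ C) (G : B ⥤ C) : Groupoid.{v} (StrictPullback F G) where
  inv {x y} f := ⟨Groupoid.inv f.fst, Groupoid.inv f.snd, by
    have h := f.w
    rw [Groupoid.inv_eq_inv, Groupoid.inv_eq_inv, Functor.map_inv, Functor.map_inv,
      IsIso.inv_comp_eq, ← Category.assoc, h, Category.assoc, IsIso.hom_inv_id,
      Category.comp_id]⟩
  inv_comp f := StrictPullback.Hom.ext (Groupoid.inv_comp _) (Groupoid.inv_comp _)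
  comp_inv f := StrictPullback.Hom.ext (Groupoid.comp_inv _) (Groupoid.comp_inv _)

/-- The first projection of the strict fiber product. -/
def StrictPullback.π₁ (F : A ⥤ C) (G : B ⥤ C) : StrictPullback F G ⥤ A where
  obj x := x.fst
  map f := f.fst

/-- The second projection of the strict fiber product. -/
def StrictPullback.π₂ (F : A ⥤ C) (G : B ⥤ C) : StrictPullback F G ⥤ B where
  obj x := x.snd
  map f := f.snd

theorem StrictPullback.w (F : A ⥤ C) (G : B ⥤ C) : π₁ F G ⋙ F = π₂ F G ⋙ G :=
  CategoryTheory.Functor.ext (fun x => x.eq) (fun x y f => by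
    have h := f.w
    rw [comp_eqToHom_iff, Category.assoc] at h
    exact h)

/-- The functor into the strict fiber product induced by a strictly commutative square. -/
def StrictPullback.lift {F : A ⥤ C} {G : B ⥤ C} (a : D ⥤ A) (b : D ⥤ B)
    (h : a ⋙ F = b ⋙ G) : D ⥤ StrictPullback F G where
  obj x := ⟨a.obj x, b.obj x, CategoryTheory.Functor.congr_obj h x⟩
  map f := ⟨a.map f, b.map f, by
    have := CategoryTheory.Functor.congr_hom h f
    dsimp at this
    simp [this]⟩
  map_id x := StrictPullback.Hom.ext (a.map_id x) (b.map_id x)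
  map_comp f g := StrictPullback.Hom.ext (a.map_comp f g) (b.map_comp f g)

/-- The functor between strict fiber products induced by a strict morphism of cospans. -/
def StrictPullback.map {F : A ⥤ C} {G : B ⥤ C} {F' : A' ⥤ C'} {G' : B' ⥤ C'}
    (α : A ⥤ A') (β : B ⥤ B') (γ : C ⥤ C') (hF : α ⋙ F' = F ⋙ γ) (hG : β ⋙ G' = G ⋙ γ) :
    StrictPullback F G ⥤ StrictPullback F' G' :=
  StrictPullback.lift (π₁ F G ⋙ α) (π₂ F G ⋙ β) (by
    rw [Functor.assoc, hF, ← Functor.assoc, StrictPullback.w, Functor.assoc, ← hG, Functor.assoc])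

theorem StrictPullback.obj_ext {F : A ⥤ C} {G : B ⥤ C} {x y : StrictPullback F G}
    (h₁ : x.fst = y.fst) (h₂ : x.snd = y.snd) : x = y := by
  cases x; cases y; cases h₁; cases h₂; rfl

theorem StrictPullback.functor_ext {F : A ⥤ C} {G : B ⥤ C} {H K : D ⥤ StrictPullback F G}
    (h₁ : H ⋙ π₁ F G = K ⋙ π₁ F G) (h₂ : H ⋙ π₂ F G = K ⋙ π₂ F G) : H = K := by
  refine CategoryTheory.Functor.ext
    (fun x => obj_ext (CategoryTheory.Functor.congr_obj h₁ x)
      (CategoryTheory.Functor.congr_obj h₂ x)) (fun x y f => ?_)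
  refine StrictPullback.hom_ext ?_ ?_
  · change (π₁ F G).map (H.map f) = (π₁ F G).map (_ ≫ _ ≫ _)
    rw [Functor.map_comp, Functor.map_comp, eqToHom_map, eqToHom_map]
    exact CategoryTheory.Functor.congr_hom h₁ f
  · change (π₂ F G).map (H.map f) = (π₂ F G).map (_ ≫ _ ≫ _)
    rw [Functor.map_comp, Functor.map_comp, eqToHom_map, eqToHom_map]
    exact CategoryTheory.Functor.congr_hom h₂ f

/-- Mathlib's category of triples `(a, b, F a ≅ G b)`, for groupoids: this is the 2-fiber
product groupoid. -/
instance (F : A ⥤ C) (G : B ⥤ C) : Groupoid.{v} (CategoricalPullback F G) where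
  inv {x y} f := ⟨Groupoid.inv f.fst, Groupoid.inv f.snd, by
    have h := f.w
    rw [Groupoid.inv_eq_inv, Groupoid.inv_eq_inv, Functor.map_inv, Functor.map_inv,
      IsIso.inv_comp_eq, ← Category.assoc, h, Category.assoc, IsIso.hom_inv_id,
      Category.comp_id]⟩
  inv_comp f := CategoricalPullback.hom_ext (Groupoid.inv_comp _) (Groupoid.inv_comp _)
  comp_inv f := CategoricalPullback.hom_ext (Groupoid.comp_inv _) (Groupoid.comp_inv _)

/-- The natural functor from the strict fiber product to the 2-fiber product,
`(a, b) ↦ (a, b, id)`. -/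
def strictToTwo (F : A ⥤ C) (G : B ⥤ C) : StrictPullback F G ⥤ CategoricalPullback F G where
  obj x := ⟨x.fst, x.snd, eqToIso x.eq⟩
  map f := ⟨f.fst, f.snd, f.w⟩

/-- The functor between 2-fiber products induced by a strict morphism of cospans:
`(a, b, φ) ↦ (α a, β b, γ φ)`. -/
def twoMap {F : A ⥤ C} {G : B ⥤ C} {F' : A' ⥤ C'} {G' : B' ⥤ C'}
    (α : A ⥤ A') (β : B ⥤ B') (γ : C ⥤ C') (hF : α ⋙ F' = F ⋙ γ) (hG : β ⋙ G' = G ⋙ γ) :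
    CategoricalPullback F G ⥤ CategoricalPullback F' G' where
  obj x := ⟨α.obj x.fst, β.obj x.snd,
    eqToIso (CategoryTheory.Functor.congr_obj hF x.fst) ≪≫ γ.mapIso x.iso ≪≫
      eqToIso (CategoryTheory.Functor.congr_obj hG x.snd).symm⟩
  map {x y} f := ⟨α.map f.fst, β.map f.snd, by
    have h₁ := CategoryTheory.Functor.congr_hom hF f.fst
    have h₂ := CategoryTheory.Functor.congr_hom hG f.snd
    have h₃ := congrArg γ.map f.w
    dsimp at h₁ h₂
    rw [Functor.map_comp, Functor.map_comp] at h₃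
    simp [h₁, h₂, reassoc_of% h₃]⟩
  map_id x := CategoricalPullback.hom_ext (α.map_id _) (β.map_id _)
  map_comp f g := CategoricalPullback.hom_ext (α.map_comp _ _) (β.map_comp _ _)

theorem two_obj_ext {F : A ⥤ C} {G : B ⥤ C} {x y : CategoricalPullback F G}
    (h₁ : x.fst = y.fst) (h₂ : x.snd = y.snd)
    (h : x.iso.hom = eqToHom (congrArg F.obj h₁) ≫ y.iso.hom ≫
      eqToHom (congrArg G.obj h₂).symm) : x = y := by
  obtain ⟨a, b, e⟩ := x
  obtain ⟨a', b', e'⟩ := y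
  cases h₁; cases h₂
  congr 1
  ext
  simpa using h

theorem two_functor_ext {F : A ⥤ C} {G : B ⥤ C} {H K : D ⥤ CategoricalPullback F G}
    (h₁ : H ⋙ CategoricalPullback.π₁ F G = K ⋙ CategoricalPullback.π₁ F G)
    (h₂ : H ⋙ CategoricalPullback.π₂ F G = K ⋙ CategoricalPullback.π₂ F G)
    (h : ∀ x, (H.obj x).iso.hom =
      eqToHom (congrArg F.obj (CategoryTheory.Functor.congr_obj h₁ x)) ≫ (K.obj x).iso.hom ≫
        eqToHom (congrArg G.obj (CategoryTheory.Functor.congr_obj h₂ x)).symm) : H = K := by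
  refine CategoryTheory.Functor.ext
    (fun x => two_obj_ext (CategoryTheory.Functor.congr_obj h₁ x)
      (CategoryTheory.Functor.congr_obj h₂ x) (h x)) (fun x y f => ?_)
  refine CategoricalPullback.hom_ext ?_ ?_
  · change (CategoricalPullback.π₁ F G).map (H.map f) =
      (CategoricalPullback.π₁ F G).map (_ ≫ _ ≫ _)
    rw [Functor.map_comp, Functor.map_comp, eqToHom_map, eqToHom_map]
    exact CategoryTheory.Functor.congr_hom h₁ f
  · change (CategoricalPullback.π₂ F G).map (H.map f) =
      (CategoricalPullback.π₂ F G).map (_ ≫ _ ≫ _)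
    rw [Functor.map_comp, Functor.map_comp, eqToHom_map, eqToHom_map]
    exact CategoryTheory.Functor.congr_hom h₂ f

theorem conj_refl {a b c d : C} (f : a ⟶ b) (h₁ : c = a) (h₂ : b = d) (h₃ : c = a) (h₄ : b = d) :
    eqToHom h₁ ≫ f ≫ eqToHom h₂ = eqToHom h₃ ≫ f ≫ eqToHom h₄ := rfl

theorem conj_trans {a b a' b' : C} {c d c' d' : C'} (γ : C ⥤ C') (f : a ⟶ b) (h₁ : c = γ.obj a)
    (h₂ : γ.obj b = d) (h₃ : c = c') (h₄ : d' = d) (h₅ : c' = γ.obj a') (h₆ : a' = a)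
    (h₇ : b = b') (h₈ : γ.obj b' = d') :
    eqToHom h₁ ≫ γ.map f ≫ eqToHom h₂ = eqToHom h₃ ≫
      (eqToHom h₅ ≫ γ.map (eqToHom h₆ ≫ f ≫ eqToHom h₇) ≫ eqToHom h₈) ≫ eqToHom h₄ := by
  subst h₆ h₇ h₂ h₅ h₈ h₃
  simp

theorem eqToHom_conj {a b c d e f : C} (h : a = b) (h₁ : a = c) (h₂ : c = d) (h₃ : d = e)
    (h₄ : e = f) (h₅ : f = b) :
    eqToHom h = eqToHom h₁ ≫ (eqToHom h₂ ≫ eqToHom h₃ ≫ eqToHom h₄) ≫ eqToHom h₅ := by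
  simp

theorem square_comp {F : A ⥤ C} {F' : A' ⥤ C'} {F'' : A'' ⥤ C''} {α : A ⥤ A'} {γ : C ⥤ C'}
    {α' : A' ⥤ A''} {γ' : C' ⥤ C''} (h : α ⋙ F' = F ⋙ γ) (h' : α' ⋙ F'' = F' ⋙ γ') :
    (α ⋙ α') ⋙ F'' = F ⋙ γ ⋙ γ' := by
  rw [Functor.assoc, h', ← Functor.assoc, h, Functor.assoc]

theorem twoMap_id (F : A ⥤ C) (G : B ⥤ C) {α : A ⥤ A} {β : B ⥤ B} {γ : C ⥤ C}
    (hα : α = 𝟭 A) (hβ : β = 𝟭 B) (hγ : γ = 𝟭 C) (hF : α ⋙ F = F ⋙ γ) (hG : β ⋙ G = G ⋙ γ) :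
    twoMap α β γ hF hG = 𝟭 (CategoricalPullback F G) := by
  subst hα hβ hγ
  exact two_functor_ext rfl rfl (fun x => by
    simp only [twoMap, Iso.trans_hom, Functor.mapIso_hom, eqToIso.hom]
    exact conj_refl _ _ _ _ _)

theorem twoMap_comp {F : A ⥤ C} {G : B ⥤ C} {F' : A' ⥤ C'} {G' : B' ⥤ C'}
    {F'' : A'' ⥤ C''} {G'' : B'' ⥤ C''}
    {α : A ⥤ A'} {β : B ⥤ B'} {γ : C ⥤ C'} (hF : α ⋙ F' = F ⋙ γ) (hG : β ⋙ G' = G ⋙ γ)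
    {α' : A' ⥤ A''} {β' : B' ⥤ B''} {γ' : C' ⥤ C''}
    (hF' : α' ⋙ F'' = F' ⋙ γ') (hG' : β' ⋙ G'' = G' ⋙ γ')
    {α'' : A ⥤ A''} {β'' : B ⥤ B''} {γ'' : C ⥤ C''}
    (hα : α'' = α ⋙ α') (hβ : β'' = β ⋙ β') (hγ : γ'' = γ ⋙ γ')
    (hF'' : α'' ⋙ F'' = F ⋙ γ'') (hG'' : β'' ⋙ G'' = G ⋙ γ'') :
    twoMap α'' β'' γ'' hF'' hG'' = twoMap α β γ hF hG ⋙ twoMap α' β' γ' hF' hG' := by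
  subst hα hβ hγ
  exact two_functor_ext rfl rfl (fun x => by
    simp only [twoMap, Iso.trans_hom, Functor.mapIso_hom, eqToIso.hom]
    exact conj_trans γ' (γ.map x.iso.hom) _ _ _ _
      (CategoryTheory.Functor.congr_obj hF' (α.obj x.fst))
      (CategoryTheory.Functor.congr_obj hF x.fst)
      (CategoryTheory.Functor.congr_obj hG x.snd).symm
      (CategoryTheory.Functor.congr_obj hG' (β.obj x.snd)).symm)

theorem map_comp_strictToTwo {F : A ⥤ C} {G : B ⥤ C} {F' : A' ⥤ C'} {G' : B' ⥤ C'}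
    {α : A ⥤ A'} {β : B ⥤ B'} {γ : C ⥤ C'} (hF : α ⋙ F' = F ⋙ γ) (hG : β ⋙ G' = G ⋙ γ) :
    StrictPullback.map α β γ hF hG ⋙ strictToTwo F' G' =
      strictToTwo F G ⋙ twoMap α β γ hF hG :=
  two_functor_ext rfl rfl (fun x => by
    simp only [strictToTwo, twoMap, Functor.comp_obj, Iso.trans_hom, Functor.mapIso_hom,
      eqToIso.hom, eqToHom_map]
    exact eqToHom_conj _ _ _ _ _ _)

end FiberProducts

/-! ### Presheaves of groupoids -/

section Presheaves

/-- The type of objects of a bundled groupoid. -/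
def El (G : Grpd.{v, v}) : Type v := G.α

instance (G : Grpd.{v, v}) : Groupoid.{v} (El G) := G.str

/-- The functor underlying a morphism of the category `Grpd` of groupoids. -/
def fn {G H : Grpd.{v, v}} (F : G ⟶ H) : El G ⥤ El H := F

variable {T : Type*} [Category* T] {X Y Z X' Y' Z' : T ⥤ Grpd.{v, v}}

theorem fn_naturality (f : X ⟶ Y) {s t : T} (a : s ⟶ t) :
    fn (X.map a) ⋙ fn (f.app t) = fn (f.app s) ⋙ fn (Y.map a) :=
  f.naturality a

/-- The strict fiber product of presheaves of groupoids, computed objectwise. -/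
def strictFiberProduct (p : X ⟶ Z) (q : Y ⟶ Z) : T ⥤ Grpd.{v, v} where
  obj t := Grpd.of (StrictPullback (fn (p.app t)) (fn (q.app t)))
  map a := StrictPullback.map (fn (X.map a)) (fn (Y.map a)) (fn (Z.map a))
    (fn_naturality p a) (fn_naturality q a)
  map_id t := StrictPullback.functor_ext
    (congrArg (fun F => StrictPullback.π₁ (fn (p.app t)) (fn (q.app t)) ⋙ fn F) (X.map_id t))
    (congrArg (fun F => StrictPullback.π₂ (fn (p.app t)) (fn (q.app t)) ⋙ fn F) (Y.map_id t))
  map_comp {r _ _} a b := StrictPullback.functor_ext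
    (congrArg (fun F => StrictPullback.π₁ (fn (p.app r)) (fn (q.app r)) ⋙ fn F) (X.map_comp a b))
    (congrArg (fun F => StrictPullback.π₂ (fn (p.app r)) (fn (q.app r)) ⋙ fn F) (Y.map_comp a b))

/-- The first projection `X ×_Z Y ⟶ X`. -/
def strictFst (p : X ⟶ Z) (q : Y ⟶ Z) : strictFiberProduct p q ⟶ X where
  app t := StrictPullback.π₁ (fn (p.app t)) (fn (q.app t))
  naturality _ _ _ := rfl

/-- The second projection `X ×_Z Y ⟶ Y`. -/
def strictSnd (p : X ⟶ Z) (q : Y ⟶ Z) : strictFiberProduct p q ⟶ Y where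
  app t := StrictPullback.π₂ (fn (p.app t)) (fn (q.app t))
  naturality _ _ _ := rfl

theorem strict_condition (p : X ⟶ Z) (q : Y ⟶ Z) : strictFst p q ≫ p = strictSnd p q ≫ q := by
  ext t
  exact StrictPullback.w (fn (p.app t)) (fn (q.app t))

/-- The 2-fiber product of presheaves of groupoids, computed objectwise: over `t` it is the
groupoid of triples `(x, y, φ)` with `x` in `X t`, `y` in `Y t` and `φ : p x ≅ q y` in `Z t`. -/
def twoFiberProduct (p : X ⟶ Z) (q : Y ⟶ Z) : T ⥤ Grpd.{v, v} where
  obj t := Grpd.of (CategoricalPullback (fn (p.app t)) (fn (q.app t)))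
  map a := twoMap (fn (X.map a)) (fn (Y.map a)) (fn (Z.map a))
    (fn_naturality p a) (fn_naturality q a)
  map_id t := twoMap_id _ _ (X.map_id t) (Y.map_id t) (Z.map_id t) _ _
  map_comp a b := twoMap_comp _ _ _ _ (X.map_comp a b) (Y.map_comp a b) (Z.map_comp a b) _ _

/-- The natural map `X ×_Z Y ⟶ X ×̃_Z Y` from the strict to the 2-fiber product,
`(x, y) ↦ (x, y, id)`. -/
def strictToTwoFiberProduct (p : X ⟶ Z) (q : Y ⟶ Z) :
    strictFiberProduct p q ⟶ twoFiberProduct p q where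
  app t := strictToTwo (fn (p.app t)) (fn (q.app t))
  naturality _ _ a := map_comp_strictToTwo (fn_naturality p a) (fn_naturality q a)

/-- The map of 2-fiber products induced by a strict morphism of cospans,
`(x, y, φ) ↦ (α x, β y, γ φ)`. -/
def twoFiberProductMap {p : X ⟶ Z} {q : Y ⟶ Z} {p' : X' ⟶ Z'} {q' : Y' ⟶ Z'}
    (α : X ⟶ X') (β : Y ⟶ Y') (γ : Z ⟶ Z') (hp : p ≫ γ = α ≫ p') (hq : q ≫ γ = β ≫ q') :
    twoFiberProduct p q ⟶ twoFiberProduct p' q' where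
  app t := twoMap (fn (α.app t)) (fn (β.app t)) (fn (γ.app t))
    (NatTrans.congr_app hp.symm t) (NatTrans.congr_app hq.symm t)
  naturality s t a :=
    (twoMap_comp (fn_naturality p a) (fn_naturality q a)
      (F'' := fn (p'.app t)) (G'' := fn (q'.app t)) (α' := fn (α.app t)) (β' := fn (β.app t))
      (γ' := fn (γ.app t))
      (NatTrans.congr_app hp.symm t) (NatTrans.congr_app hq.symm t) rfl rfl rfl
      (square_comp (fn_naturality p a) (NatTrans.congr_app hp.symm t))
      (square_comp (fn_naturality q a) (NatTrans.congr_app hq.symm t))).symm.trans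
    (twoMap_comp (F := fn (p.app s)) (G := fn (q.app s))
      (F' := fn (p'.app s)) (G' := fn (q'.app s)) (α := fn (α.app s)) (β := fn (β.app s))
      (γ := fn (γ.app s))
      (NatTrans.congr_app hp.symm s) (NatTrans.congr_app hq.symm s)
      (fn_naturality p' a) (fn_naturality q' a)
      (fn_naturality α a) (fn_naturality β a) (fn_naturality γ a) _ _)

end Presheaves

/-! ### Simplicial groupoids and Reedy fibrations -/

/-- A fibration of groupoids (an isofibration): isomorphisms `y ⟶ p x` lift to
isomorphisms `z ⟶ x`. -/
def IsGrpdFibration {G H : Type v} [Groupoid.{v} G] [Groupoid.{v} H] (p : G ⥤ H) : Prop :=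
  ∀ (x : G) (y : H) (φ : y ⟶ p.obj x),
    ∃ (z : G) (ψ : z ⟶ x) (h : p.obj z = y), p.map ψ = eqToHom h ≫ φ

section SimplicialGroupoids

/-- A map from the simplicial set `A` (viewed as a simplicial groupoid with only identity
morphisms) to the simplicial groupoid `X`. -/
structure SHom (A : SSet.{v}) (X : SimplexCategoryᵒᵖ ⥤ Grpd.{v, v}) : Type v where
  obj : ∀ m : SimplexCategoryᵒᵖ, A.obj m → El (X.obj m)
  map_obj : ∀ {m k : SimplexCategoryᵒᵖ} (f : m ⟶ k) (a : A.obj m),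
    (fn (X.map f)).obj (obj m a) = obj k (A.map f a)

/-- A 2-morphism between maps from a simplicial set to a simplicial groupoid. -/
@[ext]
structure SHom.Hom {A : SSet.{v}} {X : SimplexCategoryᵒᵖ ⥤ Grpd.{v, v}} (x y : SHom A X) :
    Type v where
  app : ∀ (m : SimplexCategoryᵒᵖ) (a : A.obj m), x.obj m a ⟶ y.obj m a
  naturality : ∀ {m k : SimplexCategoryᵒᵖ} (f : m ⟶ k) (a : A.obj m),
    (fn (X.map f)).map (app m a) ≫ eqToHom (y.map_obj f a) =
      eqToHom (x.map_obj f a) ≫ app k (A.map f a)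

variable {A : SSet.{v}} {X Y : SimplexCategoryᵒᵖ ⥤ Grpd.{v, v}}

instance : Category.{v} (SHom A X) where
  Hom x y := SHom.Hom x y
  id x := ⟨fun m a => 𝟙 _, fun f a => by simp⟩
  comp φ ψ := ⟨fun m a => φ.app m a ≫ ψ.app m a, fun f a => by
    rw [Functor.map_comp, Category.assoc, ψ.naturality, reassoc_of% (φ.naturality f a)]⟩
  id_comp φ := SHom.Hom.ext (by funext m a; exact Category.id_comp _)
  comp_id φ := SHom.Hom.ext (by funext m a; exact Category.comp_id _)
  assoc φ ψ χ := SHom.Hom.ext (by funext m a; exact Category.assoc _ _ _)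

/-- The groupoid of maps from a simplicial set to a simplicial groupoid. -/
instance : Groupoid.{v} (SHom A X) where
  inv φ := ⟨fun m a => Groupoid.inv (φ.app m a), fun f a => by
    have h := φ.naturality f a
    rw [Groupoid.inv_eq_inv, Groupoid.inv_eq_inv, Functor.map_inv,
      IsIso.inv_comp_eq, ← Category.assoc, h, Category.assoc, IsIso.hom_inv_id,
      Category.comp_id]⟩
  inv_comp φ := SHom.Hom.ext (by funext m a; exact Groupoid.inv_comp _)
  comp_inv φ := SHom.Hom.ext (by funext m a; exact Groupoid.comp_inv _)

theorem map_square {A B C D : Type v} [Category.{v} A] [Category.{v} B] [Category.{v} C]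
    [Category.{v} D] {F : A ⥤ B} {G : B ⥤ D} {H : A ⥤ C} {K : C ⥤ D} (h : F ⋙ G = H ⋙ K)
    {x y : A} {φ : x ⟶ y} {x' y' : B} {φ' : x' ⟶ y'} {hx : F.obj x = x'} {hy : F.obj y = y'}
    (e : F.map φ ≫ eqToHom hy = eqToHom hx ≫ φ') (hx' : K.obj (H.obj x) = G.obj x')
    (hy' : K.obj (H.obj y) = G.obj y') :
    K.map (H.map φ) ≫ eqToHom hy' = eqToHom hx' ≫ G.map φ' := by
  subst hx hy
  have h₁ := CategoryTheory.Functor.congr_hom h φ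
  simp only [eqToHom_refl, Category.comp_id, Category.id_comp] at e
  subst e
  dsimp only [Functor.comp_map] at h₁
  simp [h₁]

theorem map_triangle {A B C : Type v} [Category.{v} A] [Category.{v} B] [Category.{v} C]
    {F : A ⥤ B} {G : B ⥤ C} {H : A ⥤ C} (h : H = F ⋙ G) {x y : A} (φ : x ⟶ y)
    (hx : G.obj (F.obj x) = H.obj x) (hy : G.obj (F.obj y) = H.obj y) :
    G.map (F.map φ) ≫ eqToHom hy = eqToHom hx ≫ H.map φ := by
  subst h
  simp

/-- Evaluation at a simplex. -/
def SHom.ev (X : SimplexCategoryᵒᵖ ⥤ Grpd.{v, v}) {m : SimplexCategoryᵒᵖ} (a : A.obj m) :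
    SHom A X ⥤ El (X.obj m) where
  obj x := x.obj m a
  map φ := φ.app m a

theorem SHom.functor_ext {D : Type v} [Category.{v} D] {H K : D ⥤ SHom A X}
    (h : ∀ (m : SimplexCategoryᵒᵖ) (a : A.obj m), H ⋙ SHom.ev X a = K ⋙ SHom.ev X a) :
    H = K := by
  have h' : ∀ {x y : SHom A X}, x.obj = y.obj → x = y := by
    rintro ⟨x, _⟩ ⟨y, _⟩ rfl
    rfl
  refine CategoryTheory.Functor.ext (fun d => h' (by
    funext m a
    exact CategoryTheory.Functor.congr_obj (h m a) d)) (fun d e f => ?_)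
  refine SHom.Hom.ext ?_
  funext m a
  change (SHom.ev X a).map (H.map f) = (SHom.ev X a).map (_ ≫ _ ≫ _)
  rw [Functor.map_comp, Functor.map_comp, eqToHom_map, eqToHom_map]
  exact CategoryTheory.Functor.congr_hom (h m a) f

/-- Postcomposition with a map of simplicial groupoids. -/
def SHom.post (A : SSet.{v}) (p : X ⟶ Y) : SHom A X ⥤ SHom A Y where
  obj x := ⟨fun m a => (fn (p.app m)).obj (x.obj m a), fun {m k} f a =>
    (CategoryTheory.Functor.congr_obj (fn_naturality p f) (x.obj m a)).symm.trans
      (congrArg (fn (p.app k)).obj (x.map_obj f a))⟩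
  map φ := ⟨fun m a => (fn (p.app m)).map (φ.app m a), fun f a =>
    map_square (fn_naturality p f) (φ.naturality f a) _ _⟩
  map_id x := SHom.Hom.ext (by funext m a; exact (fn (p.app m)).map_id _)
  map_comp φ ψ := SHom.Hom.ext (by funext m a; exact (fn (p.app m)).map_comp _ _)

/-- The `n`-th matching groupoid `M_n X = Hom(∂Δ[n], X)`. -/
abbrev Matching (X : SimplexCategoryᵒᵖ ⥤ Grpd.{v, v}) (n : ℕ) : Type v :=
  SHom (∂Δ[n] : SSet.{v}) X

/-- The map `X_n ⟶ M_n X`, i.e. `X_n = Hom(Δ[n], X) ⟶ Hom(∂Δ[n], X)`: it sends `x` to the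
family of all `a^* x`, where `a : [m] ⟶ [n]` is a simplex of `∂Δ[n]`. -/
def toMatching (X : SimplexCategoryᵒᵖ ⥤ Grpd.{v, v}) (n : ℕ) :
    El (X.obj (op ⦋n⦌)) ⥤ Matching X n where
  obj x := ⟨fun m a => (fn (X.map (SSet.stdSimplex.objEquiv a.1).op)).obj x, fun {m k} f a =>
    (CategoryTheory.Functor.congr_obj
      (X.map_comp (SSet.stdSimplex.objEquiv a.1).op f :) x).symm⟩
  map φ := ⟨fun m a => (fn (X.map (SSet.stdSimplex.objEquiv a.1).op)).map φ, fun f a =>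
    map_triangle (X.map_comp (SSet.stdSimplex.objEquiv a.1).op f :) φ _ _⟩
  map_id x := SHom.Hom.ext (by funext m a; exact (fn (X.map _)).map_id _)
  map_comp φ ψ := SHom.Hom.ext (by funext m a; exact (fn (X.map _)).map_comp _ _)

theorem toMatching_naturality (p : X ⟶ Y) (n : ℕ) :
    toMatching X n ⋙ SHom.post _ p = fn (p.app (op ⦋n⦌)) ⋙ toMatching Y n :=
  SHom.functor_ext (fun _ a => fn_naturality p (SSet.stdSimplex.objEquiv a.1).op)

/-- A map `p : X ⟶ Y` of simplicial groupoids is a Reedy fibration if for every `n` the map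
`X_n ⟶ M_n X ×_{M_n Y} Y_n` is a fibration of groupoids. -/
def IsReedyFibrationS (p : X ⟶ Y) : Prop :=
  ∀ n : ℕ, IsGrpdFibration
    (StrictPullback.lift (toMatching X n) (fn (p.app (op ⦋n⦌))) (toMatching_naturality p n) :
      El (X.obj (op ⦋n⦌)) ⥤
        StrictPullback (SHom.post (∂Δ[n] : SSet.{v}) p) (toMatching Y n))

end SimplicialGroupoids

/-! ### Presheaves of groupoids over compactly generated Hausdorff spaces, and `Sing` -/

/-- The category of compactly generated Hausdorff spaces. -/
abbrev CGHaus : Type (u + 1) :=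
  ObjectProperty.FullSubcategory
    (fun T : TopCat.{u} => CompactlyGeneratedSpace T ∧ T2Space T)

set_option linter.checkUnivs false in
/-- The category of presheaves of groupoids over compactly generated Hausdorff spaces. -/
abbrev PshGpd : Type (max (u + 1) (v + 1)) := CGHaus.{u}ᵒᵖ ⥤ Grpd.{v, v}

/-- The cosimplicial space `n ↦ |Δ^n|`. -/
noncomputable def topSimplex : SimplexCategory ⥤ CGHaus.{u} :=
  ObjectProperty.lift _ SimplexCategory.toTop.{u} (fun n => by
    have h₁ : CompactSpace (SimplexCategory.toTop.{u}.obj n) :=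
      inferInstanceAs (CompactSpace (ULift (stdSimplex ℝ (Fin (n.len + 1)))))
    have h₂ : T2Space (SimplexCategory.toTop.{u}.obj n) :=
      inferInstanceAs (T2Space (ULift (stdSimplex ℝ (Fin (n.len + 1)))))
    exact ⟨inferInstance, h₂⟩)

/-- The restriction `X ↦ X_Δ`, `(X_Δ)_n = X(|Δ^n|)`, to simplicial groupoids. -/
noncomputable def restrictΔ : PshGpd.{u, v} ⥤ (SimplexCategoryᵒᵖ ⥤ Grpd.{v, v}) :=
  (Functor.whiskeringLeft _ _ _).obj topSimplex.{u}.op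

/-- A map of presheaves of groupoids is a Reedy fibration if its restriction to simplicial
groupoids is one. -/
def IsReedyFibration {X Y : PshGpd.{u, v}} (p : X ⟶ Y) : Prop :=
  IsReedyFibrationS (restrictΔ.map p)

/-- The levelwise nerve, from simplicial groupoids to bisimplicial sets. -/
def levelNerve : (SimplexCategoryᵒᵖ ⥤ Grpd.{v, v}) ⥤ (SimplexCategoryᵒᵖ ⥤ SSet.{v}) :=
  (Functor.whiskeringRight _ _ _).obj (Grpd.forgetToCat ⋙ nerveFunctor)

/-- The diagonal of a bisimplicial set. -/
def diag : (SimplexCategoryᵒᵖ ⥤ SSet.{v}) ⥤ SSet.{v} :=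
  Functor.uncurry ⋙ (Functor.whiskeringLeft _ _ _).obj (Functor.diag SimplexCategoryᵒᵖ)

/-- The singular simplicial set `Sing X = Diag (N (X_Δ))` of a presheaf of groupoids. -/
noncomputable def sing : PshGpd.{u, v} ⥤ SSet.{v} :=
  restrictΔ ⋙ levelNerve ⋙ diag

/-- `Sing` sends strict fiber products to fiber products of simplicial sets. -/
theorem sing_isPullback {X Y Z : PshGpd.{u, v}} (p : X ⟶ Z) (q : Y ⟶ Z) :
    IsPullback (sing.map (strictFst p q)) (sing.map (strictSnd p q))
      (sing.map p) (sing.map q) := by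
  refine IsPullback.of_forall_isPullback_app (fun n => ?_)
  rw [Types.isPullback_iff]
  refine ⟨?_, ?_, ?_⟩
  · rw [← NatTrans.comp_app, ← NatTrans.comp_app, ← Functor.map_comp, ← Functor.map_comp,
      strict_condition]
  · intro x y h
    let F := fn ((restrictΔ.map p).app n)
    let G := fn ((restrictΔ.map q).app n)
    let x' : ComposableArrows (StrictPullback F G) n.unop.len := x
    let y' : ComposableArrows (StrictPullback F G) n.unop.len := y
    exact StrictPullback.functor_ext (H := x') (K := y') h.1 h.2
  · intro x y h
    let x' : ComposableArrows (El ((restrictΔ.obj X).obj n)) n.unop.len := x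
    let y' : ComposableArrows (El ((restrictΔ.obj Y).obj n)) n.unop.len := y
    exact ⟨StrictPullback.lift (F := fn ((restrictΔ.map p).app n))
      (G := fn ((restrictΔ.map q).app n)) x' y' h, rfl, rfl⟩

/-- The natural map `Sing X ×_{Sing Z} Sing Y ⟶ Sing (X ×̃_Z Y)`: the canonical isomorphism
with `Sing (X ×_Z Y)` followed by `Sing` of the natural map `X ×_Z Y ⟶ X ×̃_Z Y`. -/
noncomputable def singComparison {X Y Z : PshGpd.{u, v}} (p : X ⟶ Z) (q : Y ⟶ Z) :
    pullback (sing.map p) (sing.map q) ⟶ sing.obj (twoFiberProduct p q) :=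
  (sing_isPullback p q).isoPullback.inv ≫ sing.map (strictToTwoFiberProduct p q)

/-- Homotopy classes of maps of simplicial sets: the quotient by the equivalence relation
generated by simplicial homotopy. -/
def HomotopyClasses (S K : SSet.{v}) : Type v :=
  Quot (fun f g : S ⟶ K => Nonempty (SSet.Homotopy f g))

/-- Precomposition on homotopy classes. -/
def HomotopyClasses.precomp {S S' : SSet.{v}} (f : S ⟶ S') (K : SSet.{v}) :
    HomotopyClasses S' K → HomotopyClasses S K :=
  Quot.map (fun g => f ≫ g) (fun _ _ ⟨h⟩ => ⟨h.precomp (SSet.RelativeMorphism.botEquiv.symm f) (by simp)⟩)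

/-- A map of simplicial sets is a weak (homotopy) equivalence if for every Kan complex `K` it
induces a bijection on homotopy classes of maps to `K`. -/
def IsWeakEquivalence {S S' : SSet.{v}} (f : S ⟶ S') : Prop :=
  ∀ K : SSet.{v}, SSet.KanComplex K → Function.Bijective (HomotopyClasses.precomp f K)

end SingStack

namespace SingStack

/-! ### Homotopy equivalences of simplicial sets -/

section HomotopyEquivalences

open MonoidalCategory CartesianMonoidalCategory

variable {S S' S'' K : SSet.{v}}

/-! The comparison is a homotopy equivalence. Let `U` be the strict and `W` the 2-fiber product of
the simplicial groupoids, with `i : U ⟶ W`. Between them sits `V`, the triples `(x, (x', y), ψ : x ≅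
x')` with `p x' = q y`, with `J : V ⟶ W`, `(x, (x', y), ψ) ↦ (x, y, p ψ)`, and the projection `π : V
⟶ U` onto `(x', y)`. A section of `J` replaces each `x`, coherently in the simplicial direction, by
an isomorphic `x'` lying strictly over `q y`.

Such a section exists for two reasons. The Reedy condition says that `J` on objects lifts against
all boundary inclusions (`exists_lift_of_boundary`), so the simplicial set of objects of `W` has a
section into that of `V`. Moreover `J` is levelwise fully faithful, so a section on objects extends
uniquely to a map `S` with `S ≫ J = 𝟙`.

The homotopy inverse of `i` is `S ≫ π`. Indeed `ψ⁻¹` is a 2-isomorphism from `π ≫ i` to `J`, whence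
`S ≫ π ≫ i ≅ 𝟙`. The diagonal `d : U ⟶ V` and `i ≫ S` both become `i` after `J`, hence are
isomorphic, whence `i ≫ S ≫ π ≅ d ≫ π = 𝟙`. Compatible families of natural transformations become
simplicial homotopies on diagonals of nerves (`Modification.homotopy`). -/

/-- A map `S ⊗ Δ[1] ⟶ K` is a homotopy between its two ends. -/
noncomputable def homotopyMk {f g : S ⟶ K} (h : S ⊗ Δ[1] ⟶ K) (h₀ : SSet.ι₀ ≫ h = f)
    (h₁ : SSet.ι₁ ≫ h = g) : SSet.Homotopy f g where
  h := h
  h₀ := h₀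
  h₁ := h₁
  rel := by
    -- The homotopy is relative to the empty subcomplex, so there is no simplex to check.
    ext n ⟨⟨x, hx⟩, t⟩
    exact hx.elim

theorem homotopic_precomp (a : S ⟶ S') {f g : S' ⟶ K} (H : Nonempty (SSet.Homotopy f g)) :
    Nonempty (SSet.Homotopy (a ≫ f) (a ≫ g)) :=
  H.map fun H => homotopyMk (a ▷ _ ≫ H.h)
    (by rw [SSet.ι₀_comp_assoc, H.h₀]) (by rw [SSet.ι₁_comp_assoc, H.h₁])

theorem homotopic_postcomp {f g : S ⟶ S'} (H : Nonempty (SSet.Homotopy f g)) (b : S' ⟶ K) :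
    Nonempty (SSet.Homotopy (f ≫ b) (g ≫ b)) :=
  H.map fun H => homotopyMk (H.h ≫ b) (by rw [H.h₀_assoc]) (by rw [H.h₁_assoc])

/-- Precomposition with `g` is a two-sided inverse: postcomposing the given homotopies with a
representative `h` relates `g ≫ f ≫ h` and `f ≫ g ≫ h` to `h`. -/
theorem isWeakEquivalence_of_homotopyInverse (f : S ⟶ S') (g : S' ⟶ S)
    (hfg : Nonempty (SSet.Homotopy (f ≫ g) (𝟙 S)))
    (hgf : Nonempty (SSet.Homotopy (g ≫ f) (𝟙 S'))) : IsWeakEquivalence f := by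
  intro K _
  refine Function.bijective_iff_has_inverse.2 ⟨HomotopyClasses.precomp g K, ?_, ?_⟩
  · rintro ⟨h⟩
    refine Quot.sound ?_
    simpa using homotopic_postcomp hgf h
  · rintro ⟨h⟩
    refine Quot.sound ?_
    simpa using homotopic_postcomp hfg h

theorem IsWeakEquivalence.comp {f : S ⟶ S'} {g : S' ⟶ S''} (hf : IsWeakEquivalence f)
    (hg : IsWeakEquivalence g) : IsWeakEquivalence (f ≫ g) := by
  intro K hK
  have : HomotopyClasses.precomp (f ≫ g) K =
      HomotopyClasses.precomp f K ∘ HomotopyClasses.precomp g K := by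
    funext x
    obtain ⟨h⟩ := x
    exact congrArg (Quot.mk _) (Category.assoc f g h)
  rw [this]
  exact (hf K hK).comp (hg K hK)

theorem isWeakEquivalence_of_isIso (f : S ⟶ S') [IsIso f] : IsWeakEquivalence f :=
  isWeakEquivalence_of_homotopyInverse f (inv f)
    ⟨by rw [IsIso.hom_inv_id]; exact homotopyMk (fst _ _) rfl rfl⟩
    ⟨by rw [IsIso.inv_hom_id]; exact homotopyMk (fst _ _) rfl rfl⟩

end HomotopyEquivalences

/-! ### Modifications and simplicial homotopies -/

section Prism

variable {C D C' D' : Type v} [Category.{v} C] [Category.{v} D] [Category.{v} C']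
  [Category.{v} D']

/-- The functor on the cylinder corresponding to a natural transformation. -/
def prism {F G : C ⥤ D} (θ : F ⟶ G) : Fin 2 × C ⥤ D :=
  Functor.uncurry.obj (ComposableArrows.mk₁ θ)

/-- This supplies the simplicial naturality of the homotopy attached to a modification. A functor on
the cylinder is an arrow of functors, so it is enough to compare two arrows of `C ⥤ D'` and then
uncurry. -/
theorem prism_naturality {F G : C ⥤ D} (θ : F ⟶ G) {F' G' : C' ⥤ D'} (θ' : F' ⟶ G')
    (a : C ⥤ C') (b : D ⥤ D') (hF : F ⋙ b = a ⋙ F') (hG : G ⋙ b = a ⋙ G')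
    (h : ∀ c, b.map (θ.app c) = eqToHom (Functor.congr_obj hF c) ≫ θ'.app (a.obj c) ≫
      eqToHom (Functor.congr_obj hG c).symm) :
    prism θ ⋙ b = (𝟭 (Fin 2)).prod a ⋙ prism θ' := by
  have : ComposableArrows.mk₁ θ ⋙ (Functor.whiskeringRight C D D').obj b =
      ComposableArrows.mk₁ θ' ⋙ (Functor.whiskeringLeft C C' D').obj a := by
    have h' : Functor.whiskerRight θ b =
        eqToHom hF ≫ Functor.whiskerLeft a θ' ≫ eqToHom hG.symm := by
      ext c
      rw [NatTrans.comp_app, NatTrans.comp_app, eqToHom_app, eqToHom_app]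
      exact h c
    exact ComposableArrows.ext₁ hF hG h'
  refine Eq.trans ?_ (congrArg Functor.uncurry.obj this)
  exact Functor.hext (fun _ => rfl) (fun _ _ _ => heq_of_eq (b.map_comp _ _))

/-- The end of the cylinder at `0`. Objects agree definitionally; on arrows, the constant first
coordinate contributes only an identity. -/
theorem prism_zero {F G : C ⥤ D} (θ : F ⟶ G) {J : Type*} [Category* J] (σ : J ⥤ C) :
    Functor.prod' ((Functor.const J).obj (0 : Fin 2)) σ ⋙ prism θ = σ ⋙ F :=
  Functor.hext (fun _ => rfl) (fun i _ f => heq_of_eq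
    ((congrArg (· ≫ F.map (σ.map f))
      (congr_app ((ComposableArrows.mk₁ θ).map_id 0) (σ.obj i))).trans (Category.id_comp _)))

theorem prism_one {F G : C ⥤ D} (θ : F ⟶ G) {J : Type*} [Category* J] (σ : J ⥤ C) :
    Functor.prod' ((Functor.const J).obj (1 : Fin 2)) σ ⋙ prism θ = σ ⋙ G :=
  Functor.hext (fun _ => rfl) (fun i _ f => heq_of_eq
    ((congrArg (· ≫ G.map (σ.map f))
      (congr_app ((ComposableArrows.mk₁ θ).map_id 1) (σ.obj i))).trans (Category.id_comp _)))

end Prism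

section Modifications

open MonoidalCategory CartesianMonoidalCategory

variable {A B : SimplexCategoryᵒᵖ ⥤ Grpd.{v, v}}

/-- A 2-morphism between maps of simplicial groupoids: a family of natural transformations
compatible with the simplicial structure. -/
structure Modification (F G : A ⟶ B) where
  app (m : SimplexCategoryᵒᵖ) : fn (F.app m) ⟶ fn (G.app m)
  naturality {m k : SimplexCategoryᵒᵖ} (f : m ⟶ k) (a : El (A.obj m)) :
    (fn (B.map f)).map ((app m).app a) =
      eqToHom (Functor.congr_obj (fn_naturality F f) a).symm ≫
        (app k).app ((fn (A.map f)).obj a) ≫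
          eqToHom (Functor.congr_obj (fn_naturality G f) a)

/-- A 2-morphism between maps of simplicial groupoids gives a simplicial homotopy between the
maps of diagonals of nerves. -/
noncomputable def Modification.homotopy {F G : A ⟶ B} (θ : Modification F G) :
    SSet.Homotopy ((levelNerve ⋙ diag).map F) ((levelNerve ⋙ diag).map G) :=
  homotopyMk
    -- On the diagonal, a simplex of degree `m` is a chain `σ : [m] ⥤ A_m` with a map `t : [m] ⥤
    -- [1]`. The pair `(t, σ)` is a chain in the cylinder on `A_m`.
    { app := fun m => ↾fun (x : ComposableArrows (El (A.obj m)) m.unop.len × Δ[1].obj m) =>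
        (Functor.prod' (SimplexCategory.toCat.map (SSet.stdSimplex.objEquiv x.2)).toFunctor x.1 ⋙
          prism (θ.app m) : ComposableArrows (El (B.obj m)) m.unop.len)
      naturality := fun m k f => by
        ext x
        obtain ⟨σ, t⟩ := x
        let σ' : ComposableArrows (El (A.obj m)) m.unop.len := σ
        -- An operator acts on the chain index, where precomposition causes no difficulty, and on
        -- the groupoids, where `prism_naturality` applies.
        exact (congrArg (fun Φ => (SimplexCategory.toCat.map f.unop).toFunctor ⋙
          Functor.prod' (SimplexCategory.toCat.map (SSet.stdSimplex.objEquiv t)).toFunctor σ' ⋙ Φ)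
          (prism_naturality (θ.app m) (θ.app k) (fn (A.map f)) (fn (B.map f))
            (fn_naturality F f).symm (fn_naturality G f).symm (θ.naturality f))).symm }
    (by
      ext m x
      exact prism_zero (θ.app m) (x : ComposableArrows (El (A.obj m)) m.unop.len))
    (by
      ext m x
      exact prism_one (θ.app m) (x : ComposableArrows (El (A.obj m)) m.unop.len))

end Modifications

/-! ### Sections of fully faithful maps of simplicial groupoids -/

section FullyFaithful

variable {C D E : Type v} [Category.{v} C] [Category.{v} D] [Category.{v} E]

/-- Faithfulness allows arrows to be compared after `F`. Objects need the separate hypothesis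
`hobj`, since `F` may identify distinct objects. -/
theorem functor_eq_of_faithful (F : C ⥤ D) [F.Faithful] {H K : E ⥤ C}
    (hobj : ∀ e, H.obj e = K.obj e) (h : H ⋙ F = K ⋙ F) : H = K :=
  CategoryTheory.Functor.ext hobj (fun _ _ f => F.map_injective (by
    rw [F.map_comp, F.map_comp, eqToHom_map, eqToHom_map]
    exact CategoryTheory.Functor.congr_hom h f))

/-- A fully faithful functor with a section on objects has a section. -/
noncomputable def sectionFunctor (F : C ⥤ D) [F.Full] [F.Faithful] (s : D → C)
    (hs : ∀ d, F.obj (s d) = d) : D ⥤ C where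
  obj := s
  map {x y} f := F.preimage (eqToHom (hs x) ≫ f ≫ eqToHom (hs y).symm)
  map_id x := F.map_injective (by simp)
  map_comp f g := F.map_injective (by simp)

theorem sectionFunctor_comp (F : C ⥤ D) [F.Full] [F.Faithful] (s : D → C)
    (hs : ∀ d, F.obj (s d) = d) : sectionFunctor F s hs ⋙ F = 𝟭 D :=
  CategoryTheory.Functor.ext hs (fun _ _ _ => F.map_preimage _)

/-- Two functors with the same composite with a fully faithful functor are isomorphic. -/
noncomputable def natTransOfCompEq (F : C ⥤ D) [F.Full] [F.Faithful] {H K : E ⥤ C}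
    (h : H ⋙ F = K ⋙ F) : H ⟶ K where
  app e := F.preimage (eqToHom (CategoryTheory.Functor.congr_obj h e))
  naturality e e' f := F.map_injective (by
    have := CategoryTheory.Functor.congr_hom h f
    dsimp at this
    simp [this])

end FullyFaithful

section SimplicialSections

variable {V W D : SimplexCategoryᵒᵖ ⥤ Grpd.{v, v}}

/-- The simplicial set of objects of a simplicial groupoid. -/
def ob : (SimplexCategoryᵒᵖ ⥤ Grpd.{v, v}) ⥤ SSet.{v} where
  obj X :=
    { obj m := El (X.obj m)
      map f := ↾(fn (X.map f)).obj
      map_id m := by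
        ext x
        exact CategoryTheory.Functor.congr_obj (X.map_id m :) x
      map_comp f g := by
        ext x
        exact CategoryTheory.Functor.congr_obj (X.map_comp f g :) x }
  map F :=
    { app m := ↾(fn (F.app m)).obj
      naturality m k f := by
        ext x
        exact CategoryTheory.Functor.congr_obj (fn_naturality F f) x }

/-- The function on objects in degree `m` given by a map of simplicial sets of objects. -/
def onObj (s : ob.obj W ⟶ ob.obj V) (m : SimplexCategoryᵒᵖ) : El (W.obj m) → El (V.obj m) :=
  fun x => s.app m x

theorem obj_section {J : V ⟶ W} {s : ob.obj W ⟶ ob.obj V} (hs : s ≫ ob.map J = 𝟙 _)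
    (m : SimplexCategoryᵒᵖ) (d : El (W.obj m)) : (fn (J.app m)).obj (onObj s m d) = d :=
  ConcreteCategory.congr_hom (NatTrans.congr_app hs m) d

/-- A levelwise fully faithful map of simplicial groupoids with a section on objects has a
section. -/
noncomputable def simplicialSection (J : V ⟶ W) [∀ m, (fn (J.app m)).Full]
    [∀ m, (fn (J.app m)).Faithful] (s : ob.obj W ⟶ ob.obj V) (hs : s ≫ ob.map J = 𝟙 _) :
    W ⟶ V where
  app m := (sectionFunctor (fn (J.app m)) (onObj s m) (obj_section hs m) :)
  naturality m k f := by
    -- On objects naturality is that of `s`; on arrows it is checked after `J`, where the section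
    -- cancels.
    refine functor_eq_of_faithful (fn (J.app k))
      (H := fn (W.map f) ⋙ sectionFunctor (fn (J.app k)) (onObj s k) (obj_section hs k))
      (K := sectionFunctor (fn (J.app m)) (onObj s m) (obj_section hs m) ⋙ fn (V.map f))
      (fun d => ConcreteCategory.congr_hom (s.naturality f) d) ?_
    rw [Functor.assoc, sectionFunctor_comp, Functor.assoc, fn_naturality, ← Functor.assoc,
      sectionFunctor_comp]
    rfl

theorem simplicialSection_comp (J : V ⟶ W) [∀ m, (fn (J.app m)).Full]
    [∀ m, (fn (J.app m)).Faithful] (s : ob.obj W ⟶ ob.obj V) (hs : s ≫ ob.map J = 𝟙 _) :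
    simplicialSection J s hs ≫ J = 𝟙 W :=
  NatTrans.ext (funext fun m =>
    sectionFunctor_comp (fn (J.app m)) (onObj s m) (obj_section hs m))

/-- Two maps of simplicial groupoids with the same composite with a levelwise fully faithful
map are isomorphic. -/
noncomputable def modificationOfCompEq (J : V ⟶ W) [∀ m, (fn (J.app m)).Full]
    [∀ m, (fn (J.app m)).Faithful] {H K : D ⟶ V} (h : H ≫ J = K ≫ J) : Modification H K where
  app m := natTransOfCompEq (fn (J.app m)) (NatTrans.congr_app h m :)
  naturality {m k} f a := (fn (J.app k)).map_injective (by
    -- The components are preimages of `eqToHom`s, so after `J` both sides are `eqToHom`s with the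
    -- same ends.
    have e := CategoryTheory.Functor.congr_hom (fn_naturality J f)
      ((natTransOfCompEq (fn (J.app m)) (NatTrans.congr_app h m :)).app a)
    refine e.trans ?_
    simp [natTransOfCompEq, eqToHom_map]
    rfl)

/-- If `J : V ⟶ W` is levelwise fully faithful with a section on objects, and `i : U ⟶ W` lifts
to `V` such that the lift has a retraction `π` with `π ≫ i` isomorphic to `J`, then `i` induces a
weak equivalence on diagonals of nerves. -/
theorem isWeakEquivalence_of_section {U : SimplexCategoryᵒᵖ ⥤ Grpd.{v, v}} (i : U ⟶ W) (J : V ⟶ W)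
    (π : V ⟶ U) (d : U ⟶ V) [∀ m, (fn (J.app m)).Full] [∀ m, (fn (J.app m)).Faithful]
    (hdJ : d ≫ J = i) (hdπ : d ≫ π = 𝟙 U) (θ : Modification (π ≫ i) J)
    (s : ob.obj W ⟶ ob.obj V) (hs : s ≫ ob.map J = 𝟙 _) :
    IsWeakEquivalence ((levelNerve ⋙ diag).map i) := by
  have hS := simplicialSection_comp J s hs
  generalize simplicialSection J s hs = S at hS
  refine isWeakEquivalence_of_homotopyInverse _ ((levelNerve ⋙ diag).map (S ≫ π)) ?_ ?_
  -- Both `i ≫ S` and `d` have composite `i` with `J`; postcomposing the resulting 2-morphism with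
  -- `π` contracts `i ≫ S ≫ π` to the identity.
  · have θ' : Modification (i ≫ S) d := modificationOfCompEq J (by
      rw [Category.assoc, hS, Category.comp_id, hdJ])
    have := homotopic_postcomp ⟨θ'.homotopy⟩ ((levelNerve ⋙ diag).map π)
    rwa [← Functor.map_comp, ← Functor.map_comp, hdπ, CategoryTheory.Functor.map_id,
      Category.assoc, Functor.map_comp] at this
  -- Restricting `θ` along `S` turns its target `J` into the identity.
  · have := homotopic_precomp ((levelNerve ⋙ diag).map S) ⟨θ.homotopy⟩
    rwa [← Functor.map_comp, ← Functor.map_comp, hS, CategoryTheory.Functor.map_id,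
      ← Category.assoc, Functor.map_comp] at this

end SimplicialSections

/-! ### The groupoid of isomorphisms `x ≅ x'` together with a lift of `p x'` -/

section LiftingGroupoid

variable {A B C : Type v} [Groupoid.{v} A] [Groupoid.{v} B] [Groupoid.{v} C]
  (F : A ⥤ C) (G : B ⥤ C)

/-- The functor `(a, (a', b), ψ) ↦ (a, b, F ψ)`. -/
abbrev liftingFunctor :
    CategoricalPullback (𝟭 A) (StrictPullback.π₁ F G) ⥤ CategoricalPullback F G :=
  twoMap (𝟭 A) (StrictPullback.π₂ F G) F rfl (StrictPullback.w F G).symm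

variable {F G} in
/-- The isomorphism `ψ` of a triple `(a, (a', b), ψ)`. -/
def liftingIso (x : CategoricalPullback (𝟭 A) (StrictPullback.π₁ F G)) : x.fst ≅ x.snd.fst :=
  x.iso

variable {F G} in
theorem liftingIso_naturality {x y : CategoricalPullback (𝟭 A) (StrictPullback.π₁ F G)}
    (f : x ⟶ y) : f.fst ≫ (liftingIso y).hom = (liftingIso x).hom ≫ f.snd.fst :=
  f.w

/-- The left square of cospans commutes by `rfl`, so only the `eqToHom` of `F x' = G y` survives
from `twoMap`. -/
theorem liftingFunctor_iso_hom (x : CategoricalPullback (𝟭 A) (StrictPullback.π₁ F G)) :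
    ((liftingFunctor F G).obj x).iso.hom = F.map (liftingIso x).hom ≫ eqToHom x.snd.eq :=
  Category.id_comp _

/-- Compatibility with the isomorphisms `ψ` forces the component on `a'` to be the conjugate by them
of the component on `a`. -/
instance : (liftingFunctor F G).Faithful where
  map_injective {x y} f g h := by
    have h₁ : f.fst = g.fst :=
      congrArg (CategoricalPullback.π₁ F G).map h
    have h₂ : f.snd.snd = g.snd.snd :=
      congrArg (CategoricalPullback.π₂ F G).map h
    have hf := liftingIso_naturality f
    have hg := liftingIso_naturality g
    refine CategoricalPullback.hom_ext h₁ (StrictPullback.hom_ext ?_ h₂)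
    exact (cancel_epi (liftingIso x).hom).1
      (hf.symm.trans ((congrArg (· ≫ (liftingIso y).hom) h₁).trans hg))

instance : (liftingFunctor F G).Full where
  map_surjective {x y} f := by
    let a : x.fst ⟶ y.fst := f.fst
    let b : x.snd.snd ⟶ y.snd.snd := f.snd
    have hf : F.map a ≫ F.map (liftingIso y).hom ≫ eqToHom y.snd.eq =
        (F.map (liftingIso x).hom ≫ eqToHom x.snd.eq) ≫ G.map b := by
      have := f.w
      rw [liftingFunctor_iso_hom, liftingFunctor_iso_hom] at this
      exact this
    -- The component on `a'` is the forced conjugate. Its agreement with `b` in `C` is exactly the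
    -- compatibility `hf`.
    refine ⟨⟨a, ⟨(liftingIso x).inv ≫ a ≫ (liftingIso y).hom, b, ?_⟩, ?_⟩, rfl⟩
    · rw [← cancel_epi (F.map (liftingIso x).hom), F.map_comp, F.map_comp, Category.assoc,
        Category.assoc, hf, ← F.map_comp_assoc, (liftingIso x).hom_inv_id, F.map_id,
        Category.id_comp, Category.assoc]
    · exact ((liftingIso x).hom_inv_id_assoc _).symm

/-- The natural transformation from `(a, (a', b), ψ) ↦ (a', b, 𝟙)` to
`(a, (a', b), ψ) ↦ (a, b, F ψ)` given by `(ψ⁻¹, 𝟙)`. -/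
def liftingTransformation :
    CategoricalPullback.π₂ (𝟭 A) (StrictPullback.π₁ F G) ⋙ strictToTwo F G ⟶
      liftingFunctor F G where
  app x := ⟨(liftingIso x).inv, 𝟙 x.snd.snd, by
    have h : F.map (liftingIso x).inv ≫ F.map (liftingIso x).hom = 𝟙 _ := by
      rw [← F.map_comp, (liftingIso x).inv_hom_id, F.map_id]
    rw [liftingFunctor_iso_hom]
    exact ((Category.assoc _ _ _).symm.trans
      ((congrArg (· ≫ eqToHom x.snd.eq) h).trans (Category.id_comp _))).trans
      ((congrArg (eqToHom x.snd.eq ≫ ·) (G.map_id _)).trans (Category.comp_id _)).symm⟩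
  naturality x y f := by
    refine CategoricalPullback.hom_ext ?_ ((Category.comp_id _).trans (Category.id_comp _).symm)
    change f.snd.fst ≫ (liftingIso y).inv = (liftingIso x).inv ≫ f.fst
    rw [Iso.comp_inv_eq, Category.assoc, liftingIso_naturality, Iso.inv_hom_id_assoc]

theorem fst_conj {x y x' y' : CategoricalPullback F G} (hx : x' = x) (hy : y = y') (f : x ⟶ y) :
    (eqToHom hx ≫ f ≫ eqToHom hy).fst =
      eqToHom (congrArg (·.fst) hx) ≫ f.fst ≫ eqToHom (congrArg (·.fst) hy) := by
  subst hx hy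
  simp

theorem snd_conj {x y x' y' : CategoricalPullback F G} (hx : x' = x) (hy : y = y') (f : x ⟶ y) :
    (eqToHom hx ≫ f ≫ eqToHom hy).snd =
      eqToHom (congrArg (·.snd) hx) ≫ f.snd ≫ eqToHom (congrArg (·.snd) hy) := by
  subst hx hy
  simp

/-- The diagonal functor `(a, b) ↦ (a, (a, b), 𝟙)`. -/
def liftingDiagonal :
    StrictPullback F G ⥤ CategoricalPullback (𝟭 A) (StrictPullback.π₁ F G) where
  obj x := ⟨x.fst, x, Iso.refl _⟩
  map f := ⟨f.fst, f, (Category.comp_id _).trans (Category.id_comp _).symm⟩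

theorem liftingDiagonal_comp : liftingDiagonal F G ⋙ liftingFunctor F G = strictToTwo F G :=
  two_functor_ext rfl rfl (fun x => by
    change ((liftingFunctor F G).obj ((liftingDiagonal F G).obj x)).iso.hom = _
    rw [liftingFunctor_iso_hom]
    change F.map (𝟙 _) ≫ eqToHom x.eq = 𝟙 _ ≫ eqToHom x.eq ≫ 𝟙 _
    rw [F.map_id, Category.comp_id])

end LiftingGroupoid

/-! ### The simplicial groupoid of lifting triples -/

section SimplicialLifting

variable {X Y Z : SimplexCategoryᵒᵖ ⥤ Grpd.{v, v}} (p : X ⟶ Z) (q : Y ⟶ Z)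

/-- The simplicial groupoid of triples `(x, (x', y), ψ : x ≅ x')` with `p x' = q y`. -/
abbrev liftingProduct : SimplexCategoryᵒᵖ ⥤ Grpd.{v, v} :=
  twoFiberProduct (𝟙 X) (strictFst p q)

/-- The map `(x, (x', y), ψ) ↦ (x, y, p ψ)`. -/
def liftingMap : liftingProduct p q ⟶ twoFiberProduct p q :=
  twoFiberProductMap (𝟙 X) (strictSnd p q) p rfl (strict_condition p q)

instance (m : SimplexCategoryᵒᵖ) : (fn ((liftingMap p q).app m)).Full :=
  inferInstanceAs (liftingFunctor (fn (p.app m)) (fn (q.app m))).Full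

instance (m : SimplexCategoryᵒᵖ) : (fn ((liftingMap p q).app m)).Faithful :=
  inferInstanceAs (liftingFunctor (fn (p.app m)) (fn (q.app m))).Faithful

/-- The projection `(x, (x', y), ψ) ↦ (x', y)`. -/
def liftingProj : liftingProduct p q ⟶ strictFiberProduct p q where
  app m := CategoricalPullback.π₂ (𝟭 (El (X.obj m)))
    (StrictPullback.π₁ (fn (p.app m)) (fn (q.app m)))
  naturality _ _ _ := rfl

/-- The diagonal `(x, y) ↦ (x, (x, y), 𝟙)`. -/
def liftingDiag : strictFiberProduct p q ⟶ liftingProduct p q where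
  app m := liftingDiagonal (fn (p.app m)) (fn (q.app m))
  naturality m k f := two_functor_ext (F := 𝟭 (El (X.obj k)))
    (G := StrictPullback.π₁ (fn (p.app k)) (fn (q.app k)))
    (H := fn ((strictFiberProduct p q).map f) ⋙ liftingDiagonal (fn (p.app k)) (fn (q.app k)))
    (K := liftingDiagonal (fn (p.app m)) (fn (q.app m)) ⋙ fn ((liftingProduct p q).map f))
    rfl rfl (fun x => by
      change 𝟙 _ = 𝟙 _ ≫ (𝟙 _ ≫ (fn (X.map f)).map (𝟙 _) ≫ 𝟙 _) ≫ 𝟙 _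
      simp)

theorem liftingDiag_comp_liftingMap :
    liftingDiag p q ≫ liftingMap p q = strictToTwoFiberProduct p q :=
  NatTrans.ext (funext fun m => liftingDiagonal_comp (fn (p.app m)) (fn (q.app m)))

theorem liftingDiag_comp_liftingProj : liftingDiag p q ≫ liftingProj p q = 𝟙 _ := rfl

/-- The isomorphism `(ψ⁻¹, 𝟙) : (x', y, 𝟙) ⟶ (x, y, p ψ)`, as a 2-morphism. -/
def liftingModification :
    Modification (liftingProj p q ≫ strictToTwoFiberProduct p q) (liftingMap p q) where
  app m := liftingTransformation (fn (p.app m)) (fn (q.app m))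
  naturality {m k} f x := by
    refine CategoricalPullback.hom_ext ?_ ?_
    · refine Eq.trans ?_ (fst_conj _ _ _ _ _).symm
      change (fn (X.map f)).map (liftingIso x).inv =
        𝟙 _ ≫ ((𝟙 _ ≫ (fn (X.map f)).map (liftingIso x).inv) ≫ 𝟙 _) ≫ 𝟙 _
      simp only [Category.comp_id, Category.id_comp]
    · refine Eq.trans ?_ (snd_conj _ _ _ _ _).symm
      change (fn (Y.map f)).map (𝟙 x.snd.snd) = 𝟙 _ ≫ 𝟙 _ ≫ 𝟙 _
      refine ((fn (Y.map f)).map_id x.snd.snd).trans ?_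
      simp only [Category.comp_id]

end SimplicialLifting

/-! ### The lifting property given by a Reedy fibration -/

/-- The definition fixes the target of the lifted arrow; passing to inverses gives the form that
fixes its source, as needed to move `x` to a new `x'`. -/
theorem IsGrpdFibration.exists_lift {G H : Type v} [Groupoid.{v} G] [Groupoid.{v} H] {p : G ⥤ H}
    (hp : IsGrpdFibration p) {x : G} {y : H} (φ : p.obj x ⟶ y) :
    ∃ (z : G) (ψ : x ⟶ z) (h : p.obj z = y), p.map ψ ≫ eqToHom h = φ := by
  obtain ⟨z, ψ, h, e⟩ := hp x y (inv φ)
  refine ⟨z, inv ψ, h, ?_⟩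
  rw [Functor.map_inv, IsIso.inv_comp_eq, e, Category.assoc, IsIso.inv_hom_id, Category.comp_id]

theorem SHom.ext_obj {A : SSet.{v}} {X : SimplexCategoryᵒᵖ ⥤ Grpd.{v, v}} {x y : SHom A X}
    (h : ∀ m a, x.obj m a = y.obj m a) : x = y := by
  obtain ⟨x, hx⟩ := x
  obtain ⟨y, hy⟩ := y
  obtain rfl : x = y := by
    funext m a
    exact h m a
  rfl

theorem SHom.comp_eqToHom_app {A : SSet.{v}} {X : SimplexCategoryᵒᵖ ⥤ Grpd.{v, v}}
    {x y z : SHom A X} (f : x ⟶ y) (h : y = z) (m : SimplexCategoryᵒᵖ) (a : A.obj m) :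
    (f ≫ eqToHom h).app m a =
      f.app m a ≫ eqToHom (congrArg (fun t : SHom A X => t.obj m a) h) := by
  subst h
  simp

theorem SHom.eqToHom_comp_app {A : SSet.{v}} {X : SimplexCategoryᵒᵖ ⥤ Grpd.{v, v}}
    {x y z : SHom A X} (f : x ⟶ y) (h : z = x) (m : SimplexCategoryᵒᵖ) (a : A.obj m) :
    (eqToHom h ≫ f).app m a =
      eqToHom (congrArg (fun t : SHom A X => t.obj m a) h) ≫ f.app m a := by
  subst h
  simp

/-! ### Transport of commutative squares along equalities of objects -/

section

variable {A B C : Type v} [Groupoid.{v} A] [Groupoid.{v} B] [Groupoid.{v} C]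
  {F : A ⥤ C} {G : B ⥤ C} {a a' b b' c c' d d' e : C}

theorem StrictPullback.comp_eqToHom_fst {x y z : StrictPullback F G} (f : x ⟶ y) (h : y = z) :
    (f ≫ eqToHom h).fst = f.fst ≫ eqToHom (congrArg (·.fst) h) := by
  subst h
  simp

theorem StrictPullback.comp_eqToHom_snd {x y z : StrictPullback F G} (f : x ⟶ y) (h : y = z) :
    (f ≫ eqToHom h).snd = f.snd ≫ eqToHom (congrArg (·.snd) h) := by
  subst h
  simp

theorem iso_hom_of_eq {x y : CategoricalPullback F G} (h : x = y) :
    x.iso.hom = eqToHom (congrArg (fun t => F.obj t.fst) h) ≫ y.iso.hom ≫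
      eqToHom (congrArg (fun t => G.obj t.snd) h).symm := by
  subst h
  simp

theorem eq_conj_of_comp_eqToHom {f : a ⟶ b} {g : c ⟶ d}
    {h₁ : b = e} {h₂ : a = c'} (h₃ : c' = c) (h₄ : d = d') {h₅ : d' = e}
    (h : f ≫ eqToHom h₁ = eqToHom h₂ ≫ (eqToHom h₃ ≫ g ≫ eqToHom h₄) ≫ eqToHom h₅)
    (h₆ : a = c) (h₇ : d = b) : f = eqToHom h₆ ≫ g ≫ eqToHom h₇ := by
  subst h₂ h₃ h₅ h₄ h₇
  simpa using h

theorem map_eqToHom_comp (K : A ⥤ C) {s t u : A} {t' u' : C} {ψ : t ⟶ u} {ψ' : t' ⟶ u'}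
    {h₁ : K.obj t = t'} {h₂ : u' = K.obj u} (h : K.map ψ = eqToHom h₁ ≫ ψ' ≫ eqToHom h₂)
    (h₃ : s = t) (h₄ : K.obj u = u') (h₅ : K.obj s = t') :
    K.map (eqToHom h₃ ≫ ψ) ≫ eqToHom h₄ = eqToHom h₅ ≫ ψ' := by
  subst h₃ h₁ h₄
  simpa using h

theorem conj_eq_conj_of_comp_eqToHom {f : a ⟶ b} {g : a' ⟶ b'}
    {h₁ : b = b'} {h₂ : a = a'} (h : f ≫ eqToHom h₁ = eqToHom h₂ ≫ g) (h₃ : c = a) (h₄ : b = d)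
    (h₅ : c = a') (h₆ : b' = d) :
    eqToHom h₃ ≫ f ≫ eqToHom h₄ = eqToHom h₅ ≫ g ≫ eqToHom h₆ := by
  subst h₁ h₂ h₃ h₄
  simpa using h

end

section BoundaryLifting

variable {X Y Z : SimplexCategoryᵒᵖ ⥤ Grpd.{v, v}} (p : X ⟶ Z) (q : Y ⟶ Z)

/-- A simplex of the simplicial groupoid of triples, with its type unfolded. -/
abbrev LiftingObj (m : SimplexCategoryᵒᵖ) : Type v :=
  CategoricalPullback (𝟭 (El (X.obj m))) (StrictPullback.π₁ (fn (p.app m)) (fn (q.app m)))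

/-- An object of a degree of the 2-fiber product, with its type unfolded. -/
abbrev TwoObj (m : SimplexCategoryᵒᵖ) : Type v :=
  CategoricalPullback (fn (p.app m)) (fn (q.app m))

/-- Write `w = (x, y, φ)`. The boundary lift provides isomorphisms `ψ_a : a^* x ≅ x'_a`, and
together with `φ` they form one arrow of `M_n X ×_{M_n Z} Z_n` starting at the image of `x`. A lift
`χ : x ⟶ z` of this arrow gives the filler `(x, (z, y), χ)`. -/
theorem exists_lift_of_boundary (hp : IsReedyFibrationS p) (n : ℕ) (w : TwoObj p q (op ⦋n⦌))
    (b : ∀ m, (∂Δ[n] : SSet.{v}).obj m → LiftingObj p q m)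
    (hb : ∀ {m k} (f : m ⟶ k) (a : (∂Δ[n] : SSet.{v}).obj m),
      (fn ((liftingProduct p q).map f)).obj (b m a) = b k ((∂Δ[n] : SSet.{v}).map f a))
    (hw : ∀ m (a : (∂Δ[n] : SSet.{v}).obj m),
      (liftingFunctor (fn (p.app m)) (fn (q.app m))).obj (b m a) =
        (fn ((twoFiberProduct p q).map (SSet.stdSimplex.objEquiv a.1).op)).obj w) :
    ∃ v : LiftingObj p q (op ⦋n⦌), (liftingFunctor _ _).obj v = w ∧
      ∀ m (a : (∂Δ[n] : SSet.{v}).obj m),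
        (fn ((liftingProduct p q).map (SSet.stdSimplex.objEquiv a.1).op)).obj v = b m a := by
  have hx (m) (a : (∂Δ[n] : SSet.{v}).obj m) : (b m a).fst =
      (fn (X.map (SSet.stdSimplex.objEquiv a.1).op)).obj w.fst :=
    congrArg CategoricalPullback.fst (hw m a)
  have hy (m) (a : (∂Δ[n] : SSet.{v}).obj m) : (b m a).snd.snd =
      (fn (Y.map (SSet.stdSimplex.objEquiv a.1).op)).obj w.snd :=
    congrArg CategoricalPullback.snd (hw m a)
  have hb₁ {m k} (f : m ⟶ k) (a : (∂Δ[n] : SSet.{v}).obj m) :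
      (fn (X.map f)).obj (b m a).fst = (b k ((∂Δ[n] : SSet.{v}).map f a)).fst :=
    congrArg CategoricalPullback.fst (hb f a)
  have hb₂ {m k} (f : m ⟶ k) (a : (∂Δ[n] : SSet.{v}).obj m) :
      (fn (X.map f)).obj (b m a).snd.fst = (b k ((∂Δ[n] : SSet.{v}).map f a)).snd.fst :=
    congrArg (fun t : LiftingObj p q k => t.snd.fst) (hb f a)
  -- The `ψ_a` are compatible with simplicial operators, hence form an arrow of the matching
  -- groupoid of `X`.
  have hψ {m k} (f : m ⟶ k) (a : (∂Δ[n] : SSet.{v}).obj m) :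
      (fn (X.map f)).map (liftingIso (b m a)).hom = eqToHom (hb₁ f a) ≫
        (liftingIso (b k ((∂Δ[n] : SSet.{v}).map f a))).hom ≫ eqToHom (hb₂ f a).symm := by
    exact ((Category.id_comp _).trans (Category.comp_id _)).symm.trans (iso_hom_of_eq (hb f a))
  -- Over `Z`, each `p ψ_a` is the restriction of `φ` along `a`, so the matching arrow and `φ` agree
  -- in `M_n Z`.
  have hpb (m) (a : (∂Δ[n] : SSet.{v}).obj m) :
      (fn (p.app m)).map (liftingIso (b m a)).hom =
        eqToHom ((congrArg (fn (p.app m)).obj (hx m a)).trans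
          (Functor.congr_obj (fn_naturality p (SSet.stdSimplex.objEquiv a.1).op) w.fst)) ≫
        (fn (Z.map (SSet.stdSimplex.objEquiv a.1).op)).map w.iso.hom ≫
        eqToHom ((Functor.congr_obj (fn_naturality q (SSet.stdSimplex.objEquiv a.1).op)
          w.snd).symm.trans ((congrArg (fn (q.app m)).obj (hy m a).symm).trans
            (b m a).snd.eq.symm)) := by
    have h := iso_hom_of_eq (hw m a)
    rw [liftingFunctor_iso_hom] at h
    exact eq_conj_of_comp_eqToHom
      (Functor.congr_obj (fn_naturality p (SSet.stdSimplex.objEquiv a.1).op) w.fst)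
      (Functor.congr_obj (fn_naturality q (SSet.stdSimplex.objEquiv a.1).op) w.snd).symm h _ _
  let T : StrictPullback (SHom.post (∂Δ[n] : SSet.{v}) p) (toMatching Z n) :=
    ⟨⟨fun m a => (b m a).snd.fst, hb₂⟩, (fn (q.app _)).obj w.snd, SHom.ext_obj fun m a =>
      (b m a).snd.eq.trans ((congrArg (fn (q.app m)).obj (hy m a)).trans
        (Functor.congr_obj (fn_naturality q (SSet.stdSimplex.objEquiv a.1).op) w.snd))⟩
  let R : StrictPullback (SHom.post (∂Δ[n] : SSet.{v}) p) (toMatching Z n) :=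
    (StrictPullback.lift (toMatching X n) (fn (p.app (op ⦋n⦌)))
      (toMatching_naturality p n)).obj w.fst
  let Ψ : R ⟶ T :=
    ⟨⟨fun m a => eqToHom (hx m a).symm ≫ (liftingIso (b m a)).hom, fun {m k} f a =>
        (map_eqToHom_comp (fn (X.map f)) (hψ f a) _ _
          ((congrArg (fn (X.map f)).obj (hx m a)).symm.trans (hb₁ f a))).trans
          (eqToHom_trans_assoc _ _ _).symm⟩, w.iso.hom, by
      refine SHom.Hom.ext ?_
      funext m a
      exact (SHom.comp_eqToHom_app _ _ _ _).trans
        ((map_eqToHom_comp (fn (p.app m)) (hpb m a) _ _ _).trans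
          (SHom.eqToHom_comp_app ((toMatching Z n).map w.iso.hom) R.eq m a).symm)⟩
  -- The second component of `h` says `p z = q y` and the first that `z` has boundary `x'`; likewise
  -- `hχ` says that `χ` lies over `φ` and restricts to the `ψ_a`.
  obtain ⟨z, χ, h, hχ⟩ := (hp n).exists_lift Ψ
  have hz : (fn (p.app (op ⦋n⦌))).obj z = (fn (q.app (op ⦋n⦌))).obj w.snd :=
    congrArg StrictPullback.snd h
  have hza (m) (a : (∂Δ[n] : SSet.{v}).obj m) :
      (fn (X.map (SSet.stdSimplex.objEquiv a.1).op)).obj z = (b m a).snd.fst :=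
    congrArg (fun t : StrictPullback (SHom.post (∂Δ[n] : SSet.{v}) p) (toMatching Z n) =>
      t.fst.obj m a) h
  have hχ₁ : (fn (p.app (op ⦋n⦌))).map χ ≫ eqToHom hz = w.iso.hom :=
    (StrictPullback.comp_eqToHom_snd _ h).symm.trans
      (congrArg (fun t : _ ⟶ T => StrictPullback.Hom.snd t) hχ)
  have hχ₂ (m) (a : (∂Δ[n] : SSet.{v}).obj m) :
      (fn (X.map (SSet.stdSimplex.objEquiv a.1).op)).map χ ≫ eqToHom (hza m a) =
        eqToHom (hx m a).symm ≫ (liftingIso (b m a)).hom := by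
    have h₁ := (StrictPullback.comp_eqToHom_fst _ h).symm.trans
      (congrArg (fun t : _ ⟶ T => StrictPullback.Hom.fst t) hχ)
    exact (SHom.comp_eqToHom_app _ _ m a).symm.trans
      (congrArg (fun t : _ ⟶ T.fst => SHom.Hom.app t m a) h₁)
  refine ⟨⟨w.fst, ⟨z, w.snd, hz⟩, (Groupoid.isoEquivHom _ _).symm χ⟩, two_obj_ext rfl rfl ?_, fun m a =>
    two_obj_ext (hx m a).symm (StrictPullback.obj_ext (hza m a) (hy m a).symm) ?_⟩
  · rw [liftingFunctor_iso_hom]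
    exact hχ₁.trans ((Category.id_comp _).trans (Category.comp_id _)).symm
  · exact conj_eq_conj_of_comp_eqToHom (hχ₂ m a) rfl rfl _ _

end BoundaryLifting

/-! ### The comparison of fiber products -/

section Comparison

variable {X Y Z : SimplexCategoryᵒᵖ ⥤ Grpd.{v, v}} (p : X ⟶ Z) (q : Y ⟶ Z)

/-- By Yoneda, a square from `∂Δ[n] ⟶ Δ[n]` is an object of degree `n` of the 2-fiber product with a
lift of its boundary. -/
theorem rlp_ob_map_liftingMap (hp : IsReedyFibrationS p) :
    SSet.modelCategoryQuillen.I.rlp (ob.map (liftingMap p q)) := by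
  rintro _ _ _ ⟨n⟩
  refine ⟨fun {t w} sq => ?_⟩
  obtain ⟨v, hv, hvb⟩ := exists_lift_of_boundary p q hp n (SSet.yonedaEquiv w)
    (fun m a => t.app m a)
    (fun f a => (ConcreteCategory.congr_hom (t.naturality f) a).symm)
    (fun m a => by
      refine (ConcreteCategory.congr_hom (NatTrans.congr_app sq.w m) a).trans ?_
      obtain ⟨w, rfl⟩ := SSet.yonedaEquiv.symm.surjective w
      rw [Equiv.apply_symm_apply]
      rfl)
  refine ⟨⟨⟨SSet.yonedaEquiv.symm (show (ob.obj (liftingProduct p q)).obj (op ⦋n⦌) from v),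
    ?_, ?_⟩⟩⟩
  · ext m a
    exact hvb m a
  · rw [SSet.yonedaEquiv_symm_comp, Equiv.symm_apply_eq]
    exact hv

/-- Lifting against boundary inclusions implies lifting against all monomorphisms; the section is a
lift of the identity against the inclusion of the empty simplicial set. -/
theorem exists_section_liftingMap (hp : IsReedyFibrationS p) :
    ∃ s : ob.obj (twoFiberProduct p q) ⟶ ob.obj (liftingProduct p q),
      s ≫ ob.map (liftingMap p q) = 𝟙 _ := by
  have h := rlp_ob_map_liftingMap p q hp
  rw [← SSet.rlp_monomorphisms] at h
  have := h (initial.to (ob.obj (twoFiberProduct p q))) inferInstance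
  have sq : CommSq (initial.to _) (initial.to (ob.obj (twoFiberProduct p q)))
    (ob.map (liftingMap p q)) (𝟙 _) := ⟨initial.hom_ext _ _⟩
  exact ⟨sq.lift, sq.fac_right⟩

theorem isWeakEquivalence_strictToTwo (hp : IsReedyFibrationS p) :
    IsWeakEquivalence ((levelNerve ⋙ diag).map (strictToTwoFiberProduct p q)) := by
  obtain ⟨s, hs⟩ := exists_section_liftingMap p q hp
  exact isWeakEquivalence_of_section _ (liftingMap p q) (liftingProj p q) (liftingDiag p q)
    (liftingDiag_comp_liftingMap p q) (liftingDiag_comp_liftingProj p q)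
    (liftingModification p q) s hs

end Comparison

/-! ### Naturality in the cospan -/

section Naturality

variable {T : Type*} [Category* T] {X Y Z X' Y' Z' : T ⥤ Grpd.{v, v}}
  {p : X ⟶ Z} {q : Y ⟶ Z} {p' : X' ⟶ Z'} {q' : Y' ⟶ Z'}

/-- The map of strict fiber products induced by a strict morphism of cospans. -/
def strictFiberProductMap (α : X ⟶ X') (β : Y ⟶ Y') (γ : Z ⟶ Z') (hp : p ≫ γ = α ≫ p')
    (hq : q ≫ γ = β ≫ q') : strictFiberProduct p q ⟶ strictFiberProduct p' q' where
  app t := StrictPullback.map (fn (α.app t)) (fn (β.app t)) (fn (γ.app t))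
    (NatTrans.congr_app hp.symm t) (NatTrans.congr_app hq.symm t)
  naturality s _ a := StrictPullback.functor_ext
    (congrArg (StrictPullback.π₁ (fn (p.app s)) (fn (q.app s)) ⋙ ·) (fn_naturality α a))
    (congrArg (StrictPullback.π₂ (fn (p.app s)) (fn (q.app s)) ⋙ ·) (fn_naturality β a))

theorem strictFiberProductMap_comp_strictToTwo (α : X ⟶ X') (β : Y ⟶ Y') (γ : Z ⟶ Z')
    (hp : p ≫ γ = α ≫ p') (hq : q ≫ γ = β ≫ q') :
    strictFiberProductMap α β γ hp hq ≫ strictToTwoFiberProduct p' q' =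
      strictToTwoFiberProduct p q ≫ twoFiberProductMap α β γ hp hq :=
  NatTrans.ext (funext fun t => map_comp_strictToTwo
    (NatTrans.congr_app hp.symm t) (NatTrans.congr_app hq.symm t))

end Naturality

/-- Both fiber products are objectwise, so restriction to simplicial groupoids preserves them
definitionally and the simplicial result applies to the second factor. -/
theorem isWeakEquivalence_singComparison {X Y Z : PshGpd.{u, v}} (p : X ⟶ Z) (q : Y ⟶ Z)
    (hp : IsReedyFibration p) : IsWeakEquivalence (singComparison p q) :=
  (isWeakEquivalence_of_isIso _).comp
    (isWeakEquivalence_strictToTwo (restrictΔ.map p) (restrictΔ.map q) hp)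

/-- This moves naturality from pullbacks of simplicial sets to strict fiber products of presheaves.
Maps into a pullback are compared after its two projections. -/
theorem isoPullback_inv_naturality {X Y Z X' Y' Z' : PshGpd.{u, v}} {p : X ⟶ Z} {q : Y ⟶ Z}
    {p' : X' ⟶ Z'} {q' : Y' ⟶ Z'} (α : X ⟶ X') (β : Y ⟶ Y') (γ : Z ⟶ Z')
    (hα : p ≫ γ = α ≫ p') (hβ : q ≫ γ = β ≫ q')
    (h₁ : sing.map p ≫ sing.map γ = sing.map α ≫ sing.map p')
    (h₂ : sing.map q ≫ sing.map γ = sing.map β ≫ sing.map q') :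
    pullback.map (sing.map p) (sing.map q) (sing.map p') (sing.map q')
        (sing.map α) (sing.map β) (sing.map γ) h₁ h₂ ≫ (sing_isPullback p' q').isoPullback.inv =
      (sing_isPullback p q).isoPullback.inv ≫
        sing.map (strictFiberProductMap α β γ hα hβ) := by
  have e₁ : strictFiberProductMap α β γ hα hβ ≫ strictFst p' q' = strictFst p q ≫ α := rfl
  have e₂ : strictFiberProductMap α β γ hα hβ ≫ strictSnd p' q' = strictSnd p q ≫ β := rfl
  refine (sing_isPullback p' q').hom_ext ?_ ?_
  · rw [Category.assoc, Category.assoc, ← Functor.map_comp, e₁, Functor.map_comp,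
      IsPullback.isoPullback_inv_fst, IsPullback.isoPullback_inv_fst_assoc, pullback.map,
      pullback.lift_fst]
  · rw [Category.assoc, Category.assoc, ← Functor.map_comp, e₂, Functor.map_comp,
      IsPullback.isoPullback_inv_snd, IsPullback.isoPullback_inv_snd_assoc, pullback.map,
      pullback.lift_snd]

end SingStack

open SingStack in
theorem lemmaL {X Y Z : PshGpd.{u, v}} (p : X ⟶ Z) (q : Y ⟶ Z) (hp : IsReedyFibration p) :
    IsWeakEquivalence (singComparison p q) ∧
    ∀ {X' Y' Z' : PshGpd.{u, v}} (p' : X' ⟶ Z') (q' : Y' ⟶ Z')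
      (α : X ⟶ X') (β : Y ⟶ Y') (γ : Z ⟶ Z') (hα : p ≫ γ = α ≫ p') (hβ : q ≫ γ = β ≫ q'),
      pullback.map (sing.map p) (sing.map q) (sing.map p') (sing.map q')
          (sing.map α) (sing.map β) (sing.map γ)
          (by rw [← Functor.map_comp, ← Functor.map_comp, hα])
          (by rw [← Functor.map_comp, ← Functor.map_comp, hβ]) ≫ singComparison p' q' =
        singComparison p q ≫ sing.map (twoFiberProductMap α β γ hα hβ) := by
  refine ⟨isWeakEquivalence_singComparison p q hp, fun p' q' α β γ hα hβ => ?_⟩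
  rw [singComparison, singComparison, ← Category.assoc,
    isoPullback_inv_naturality α β γ hα hβ, Category.assoc, Category.assoc, ← Functor.map_comp,
    ← Functor.map_comp, strictFiberProductMap_comp_strictToTwo]
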